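/- A Rogers–Ramanujan partition is a partition (into positive integers) in which any two consecutive parts differ by at least $2$; let $\mathcal{R}_2$ be the set of those that do not have $1$ as a part (the empty partition of $0$ is included). A string of $\pi \in \mathcal{R}_2$ is a maximal sequence of parts of $\pi$ in which the difference between consecutive parts is at most $3$; every $\pi\in\mathcal R_2$ decomposes uniquely into strings. For a string $\psi$ let $\eta=\eta(\psi)$ be the number of gaps between consecutive parts of $\psi$ that are equal to $3$, let $F_0=0$, $F_1=1$, $F_m=F_{m-1}+F_{m-2}$ for $m \ge 2$ be the Fibonacci numbers, and put $$ \omega_7(\psi)=\begin{cases} F_{\eta+3}, & \text{if all parts of } \psi \text{ are} \ge 4,\\ F_{\eta+2}, & \text{if either } 2\in\psi,\ 4\notin\psi \text{ and } 5\notin\psi, \text{ or } 3\in\psi,\\ F_{\eta+1}, & \text{if } 2\in\psi \text{ and either } 4 \text{ or } 5\in\psi, \end{cases} $$ and $\omega_7(\pi)=\prod_{\psi}\omega_7(\psi)$, the product being over all strings $\psi$ of $\pi$ (an empty product is $1$). For an integer $n \ge 0$ let $A_{7,1}(n)$ denote the number of partitions of $n$ into parts $\not\equiv 0,\pm 1 \pmod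 7$. Then $$ A_{7,1}(n)=\sum_{\pi\in\mathcal{R}_2,\ \sigma(\pi)=n}\omega_7(\pi), $$ where $\sigma(\pi)$ is the sum of the parts of $\pi$. -/

import Mathlib

/-- The parts of a partition, listed in increasing order. -/
def sortedParts {n : ℕ} (π : n.Partition) : List ℕ :=
  π.parts.sort (· ≤ ·)

/-- A Rogers–Ramanujan partition: consecutive parts differ by at least `2`
(in particular no part is repeated). -/
def IsRogersRamanujan {n : ℕ} (π : n.Partition) : Prop :=
  (sortedParts π).IsChain (fun a b => a + 2 ≤ b)

instance {n : ℕ} (π : n.Partition) : Decidable (IsRogersRamanujan π) := by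
  unfold IsRogersRamanujan
  infer_instance

/-- The strings of a partition: the maximal sequences of parts in which the difference between
consecutive parts is at most `3`. Each string is listed in increasing order. -/
def strings {n : ℕ} (π : n.Partition) : List (List ℕ) :=
  (sortedParts π).splitBy (fun a b => decide (b ≤ a + 3))

/-- The number `η` of gaps equal to `3` between consecutive parts of a string. -/
def gapsThree (ψ : List ℕ) : ℕ :=
  (ψ.zip ψ.tail).countP (fun p => decide (p.2 = p.1 + 3))

/-- The weight of a string. A string of a Rogers–Ramanujan partition without part `1` always falls
under exactly one of the first three cases; the value `0` is never used for it. -/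
def stringWeight (ψ : List ℕ) : ℕ :=
  if ∀ p ∈ ψ, 4 ≤ p then Nat.fib (gapsThree ψ + 3)
  else if (2 ∈ ψ ∧ 4 ∉ ψ ∧ 5 ∉ ψ) ∨ 3 ∈ ψ then Nat.fib (gapsThree ψ + 2)
  else if 2 ∈ ψ ∧ (4 ∈ ψ ∨ 5 ∈ ψ) then Nat.fib (gapsThree ψ + 1)
  else 0

/-- The weight of a partition: the product of the weights of its strings. -/
def partitionWeight {n : ℕ} (π : n.Partition) : ℕ :=
  ((strings π).map stringWeight).prod

/-- The Rogers–Ramanujan partitions of `n` that do not have `1` as a part. -/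
def rogersRamanujanWithoutOne (n : ℕ) : Finset n.Partition :=
  Finset.univ.filter (fun π => IsRogersRamanujan π ∧ 1 ∉ π.parts)

/-- The number of partitions of `n` into parts not congruent to `0`, `1` or `-1` modulo `7`. -/
def numPartitionsModSeven (n : ℕ) : ℕ :=
  (Finset.univ.filter (fun π : n.Partition => ∀ p ∈ π.parts,
    ¬ (p : ℤ) ≡ 0 [ZMOD 7] ∧ ¬ (p : ℤ) ≡ 1 [ZMOD 7] ∧ ¬ (p : ℤ) ≡ -1 [ZMOD 7])).card

/-! Both sides are the coefficient of `q^n` in `∑ₛ q^(s²+s) ∑_{i+j=s} q^(j²+j) / ((q)ᵢ (q)ⱼ)`.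

For the partitions modulo `7` this is an Andrews–Gordon identity. Three steps of the Bailey chain
with `a = q` (`baileyBeta_mul`), starting at the unit pair, turn the double sum into the theta
series `∑ q^(3(k²+k)) αₖ`. The triple product with base `q⁷`, `z = q`, `w = q⁶` then factors that
series. The Bailey argument uses finite sums only, compared modulo `q^(N+1)`.

For the weighted sum, the `s`-th term is the contribution of the partitions with `s` parts. If a
string is cut into runs of gap `2`, then `F_{η+3}` counts the sets of pairwise nonadjacent runs
among its `η + 1` runs; `F_{η+2}` and `F_{η+1}` count those that avoid or contain the first run.
Removing the smallest part gives a recurrence governed by whether the next gap is `2`, `3` or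
larger, and `squareSum` solves it (`sum_runWeights`). The three cases of `ω₇` amount to prepending a
part `0` and counting the sets that contain its run, which leads to `sum_listWeight`. -/

open Finset

/-! ### Finite `q`-binomial sums and the triple product -/

/-- `P n` is the inverse of the `q`-factorial `(1 - q) (1 - q²) ⋯ (1 - qⁿ)`. -/
structure IsQFactorialInv {R : Type*} [CommRing R] (q : R) (P : ℕ → R) : Prop where
  zero : P 0 = 1
  succ : ∀ n, P n = (1 - q ^ (n + 1)) * P (n + 1)

/-- The truncated theta coefficient with exponent `j - m`: `(-1)ᵏ zᵏ q^(k choose 2)` if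
`k = j - m ≥ 0`, and `(-1)ᵏ wᵏ q^(k choose 2)` if `k = m - j > 0`. -/
def thetaCoeff {R : Type*} [CommRing R] (q z w : R) (m j : ℕ) : R :=
  if m ≤ j then (-1) ^ (j - m) * z ^ (j - m) * q ^ (j - m).choose 2
  else (-1) ^ (m - j) * w ^ (m - j) * q ^ (m - j).choose 2

theorem thetaCoeff_succ_succ {R : Type*} [CommRing R] (q z w : R) (m j : ℕ) :
    thetaCoeff q z w (m + 1) (j + 1) = thetaCoeff q z w m j := by
  simp [thetaCoeff]

/-- Since `w` plays the role of `q / z`, both branches of `thetaCoeff` are `(-1)ᵗ zᵗ q^(t(t-1)/2)`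
with `t = j - m ∈ ℤ`, and consecutive values have ratio `-z qᵗ`. The factor `q ^ i` clears the
possibly negative power, because `i + t = n`. -/
theorem thetaCoeff_shift_right {R : Type*} [CommRing R] {q z w : R} (hzw : z * w = q)
    {m n i j : ℕ} (h : i + j = m + n) :
    q ^ i * thetaCoeff q z w m (j + 1) = -(z * q ^ n) * thetaCoeff q z w m j := by
  rcases le_or_gt m j with hmj | hmj
  · obtain ⟨k, rfl⟩ := Nat.exists_eq_add_of_le hmj
    have hn : n = i + k := by omega
    subst hn
    simp only [thetaCoeff, if_pos (show m ≤ m + k by omega), if_pos (show m ≤ m + k + 1 by omega),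
      show m + k + 1 - m = k + 1 by omega, show m + k - m = k by omega, Nat.choose_succ_succ' k 1,
      Nat.choose_one_right]
    ring
  · obtain ⟨k, rfl⟩ := Nat.exists_eq_add_of_lt hmj
    have hi : i = k + 1 + n := by omega
    subst hi
    simp only [thetaCoeff, if_neg (show ¬ j + k + 1 ≤ j by omega),
      show j + k + 1 - j = k + 1 by omega, Nat.choose_succ_succ' k 1, Nat.choose_one_right]
    rcases Nat.eq_zero_or_pos k with rfl | hk
    · simp
      linear_combination (-q ^ n) * hzw
    · rw [if_neg (by omega), show j + k + 1 - (j + 1) = k by omega]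
      linear_combination (-q ^ n * (-1) ^ k * w ^ k * q ^ k * q ^ k.choose 2) * hzw

theorem thetaCoeff_shift_left {R : Type*} [CommRing R] {q z w : R} (hzw : z * w = q) (m j : ℕ) :
    q ^ j * thetaCoeff q z w (m + 1) j = -(w * q ^ m) * thetaCoeff q z w m j := by
  rcases lt_or_ge m j with hmj | hmj
  · obtain ⟨k, rfl⟩ := Nat.exists_eq_add_of_lt hmj
    simp only [thetaCoeff, if_pos (show m ≤ m + k + 1 by omega),
      if_pos (show m + 1 ≤ m + k + 1 by omega),
      show m + k + 1 - m = k + 1 by omega, show m + k + 1 - (m + 1) = k by omega,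
      Nat.choose_succ_succ' k 1, Nat.choose_one_right]
    linear_combination (-q ^ m * (-1) ^ k * z ^ k * q ^ k * q ^ k.choose 2) * hzw
  · obtain ⟨k, rfl⟩ := Nat.exists_eq_add_of_le hmj
    simp only [thetaCoeff, if_neg (show ¬ j + k + 1 ≤ j by omega),
      show j + k + 1 - j = k + 1 by omega, Nat.choose_succ_succ' k 1, Nat.choose_one_right]
    rcases Nat.eq_zero_or_pos k with rfl | hk
    · simp
      ring
    · rw [if_neg (by omega), show j + k - j = k by omega]
      ring

/-- This folds a bilateral theta sum about its centre into the one-sided form required by a Bailey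
pair. -/
theorem Finset.sum_antidiagonal_eq_add_reflect {M : Type*} [AddCommMonoid M] (f : ℕ × ℕ → M)
    (n : ℕ) :
    ∑ p ∈ antidiagonal (n + (n + 1)), f p =
      ∑ p ∈ antidiagonal n, (f (p.1 + 2 * p.2 + 1, p.1) + f (p.1, p.1 + 2 * p.2 + 1)) := by
  rw [Finset.Nat.sum_antidiagonal_eq_sum_range_succ_mk,
    Finset.Nat.sum_antidiagonal_eq_sum_range_succ_mk,
    show (n + (n + 1)).succ = (n + 1) + (n + 1) by omega, Finset.sum_range_add,
    Finset.sum_add_distrib, add_comm (∑ k ∈ range n.succ, _)]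
  congr 1
  · rw [← Finset.sum_range_reflect]
    refine Finset.sum_congr rfl fun k hk => ?_
    have := Finset.mem_range.1 hk
    exact congrArg f (Prod.ext (by simp; omega) (by simp; omega))
  · refine Finset.sum_congr rfl fun k hk => ?_
    have := Finset.mem_range.1 hk
    exact congrArg f (Prod.ext rfl (by simp; omega))

namespace IsQFactorialInv

variable {R : Type*} [CommRing R] {q : R} {P : ℕ → R}

theorem isUnit (h : IsQFactorialInv q P) (n : ℕ) : IsUnit (P n) := by
  induction n with
  | zero => rw [h.zero]; exact isUnit_one
  | succ n ih => rw [h.succ n] at ih; exact (IsUnit.mul_iff.1 ih).2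

theorem isUnit_one_sub (h : IsQFactorialInv q P) (n : ℕ) : IsUnit (1 - q ^ (n + 1)) := by
  have := h.isUnit n
  rw [h.succ n] at this
  exact (IsUnit.mul_iff.1 this).1

theorem prod_mul (h : IsQFactorialInv q P) (n : ℕ) :
    (∏ i ∈ range n, (1 - q ^ (i + 1))) * P n = 1 := by
  induction n with
  | zero => simp [h.zero]
  | succ n ih => rw [prod_range_succ, mul_assoc, ← h.succ, ih]

/-- The factor `1 - q ^ i` kills the term `i = 0` and lowers `P i` to `P (i - 1)` elsewhere. With
`sum_snd`, this is the source of every recurrence for `q`-binomial sums below. -/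
theorem sum_fst (h : IsQFactorialInv q P) (g : ℕ → ℕ → R) (n : ℕ) :
    ∑ p ∈ antidiagonal (n + 1), P p.1 * P p.2 * ((1 - q ^ p.1) * g p.1 p.2) =
      ∑ p ∈ antidiagonal n, P p.1 * P p.2 * g (p.1 + 1) p.2 := by
  rw [Finset.Nat.sum_antidiagonal_succ]
  simp only [pow_zero, sub_self, zero_mul, mul_zero, zero_add]
  refine sum_congr rfl fun p _ => ?_
  rw [h.succ p.1]
  ring

theorem sum_snd (h : IsQFactorialInv q P) (g : ℕ → ℕ → R) (n : ℕ) :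
    ∑ p ∈ antidiagonal (n + 1), P p.1 * P p.2 * ((1 - q ^ p.2) * g p.1 p.2) =
      ∑ p ∈ antidiagonal n, P p.1 * P p.2 * g p.1 (p.2 + 1) := by
  rw [Finset.Nat.sum_antidiagonal_succ']
  simp only [pow_zero, sub_self, zero_mul, mul_zero, zero_add]
  refine sum_congr rfl fun p _ => ?_
  rw [h.succ p.2]
  ring

/-- The Pascal rule for `q`-binomial sums. -/
theorem sum_pascal (h : IsQFactorialInv q P) (g : ℕ → R) (n : ℕ) :
    (1 - q ^ (n + 1)) * ∑ p ∈ antidiagonal (n + 1), P p.1 * P p.2 * g p.2 =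
      ∑ p ∈ antidiagonal n, P p.1 * P p.2 * (g p.2 + q ^ p.1 * g (p.2 + 1)) := by
  have h1 := h.sum_fst (fun _ j => g j) n
  have h2 := h.sum_snd (fun i j => q ^ i * g j) n
  simp only [mul_add, sum_add_distrib]
  rw [← h1, ← h2, ← sum_add_distrib, mul_sum]
  refine sum_congr rfl fun p hp => ?_
  rw [← mem_antidiagonal.1 hp]
  ring

/-- The second Pascal rule for `q`-binomial sums. -/
theorem sum_pascal' (h : IsQFactorialInv q P) (g : ℕ → R) (n : ℕ) :
    (1 - q ^ (n + 1)) * ∑ p ∈ antidiagonal (n + 1), P p.1 * P p.2 * g p.2 =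
      ∑ p ∈ antidiagonal n, P p.1 * P p.2 * (q ^ p.2 * g p.2 + g (p.2 + 1)) := by
  have h1 := h.sum_fst (fun _ j => q ^ j * g j) n
  have h2 := h.sum_snd (fun _ j => g j) n
  simp only [mul_add, sum_add_distrib]
  rw [← h1, ← h2, ← sum_add_distrib, mul_sum]
  refine sum_congr rfl fun p hp => ?_
  rw [← mem_antidiagonal.1 hp]
  ring

/-- A case of the `q`-Chu–Vandermonde summation. -/
theorem vandermonde (h : IsQFactorialInv q P) (n c : ℕ) :
    ∑ p ∈ antidiagonal n, P p.1 * P p.2 * (q ^ (p.2 ^ 2 + p.2 * c) * P (p.2 + c)) =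
      P n * P (n + c) := by
  induction n generalizing c with
  | zero => simp [h.zero]
  | succ n ih =>
    apply (h.isUnit_one_sub n).mul_left_cancel
    rw [h.sum_pascal (fun j => q ^ (j ^ 2 + j * c) * P (j + c))]
    -- For `i + j = n`, `i + (j+1)² + (j+1)c = (n+1+c) + j² + j(c+1)`, so the shifted half is the
    -- same sum with `c + 1`; hence the induction is over all `c`.
    have key : ∀ p ∈ antidiagonal n, P p.1 * P p.2 * (q ^ (p.2 ^ 2 + p.2 * c) * P (p.2 + c) +
        q ^ p.1 * (q ^ ((p.2 + 1) ^ 2 + (p.2 + 1) * c) * P (p.2 + 1 + c))) =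
        P p.1 * P p.2 * (q ^ (p.2 ^ 2 + p.2 * c) * P (p.2 + c)) + q ^ (n + 1 + c) *
        (P p.1 * P p.2 * (q ^ (p.2 ^ 2 + p.2 * (c + 1)) * P (p.2 + (c + 1)))) := by
      intro p hp
      rw [← mem_antidiagonal.1 hp, show p.2 + 1 + c = p.2 + (c + 1) by ring]
      ring
    rw [sum_congr rfl key, sum_add_distrib, ← mul_sum, ih, ih, ← mul_assoc (1 - _), ← h.succ n,
      h.succ (n + c), show n + (c + 1) = n + c + 1 by ring, show n + 1 + c = n + c + 1 by ring]
    ring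

/-- The finite Jacobi triple product identity. -/
theorem sum_thetaCoeff (h : IsQFactorialInv q P) {z w : R} (hzw : z * w = q) (m n : ℕ) :
    ∑ p ∈ antidiagonal (m + n), P p.1 * P p.2 * thetaCoeff q z w m p.2 =
      (∏ i ∈ range n, (1 - z * q ^ i)) * (∏ i ∈ range m, (1 - w * q ^ i)) * P (m + n) := by
  induction n with
  | zero =>
    induction m with
    | zero => simp [h.zero, thetaCoeff]
    | succ m ih =>
      apply (h.isUnit_one_sub m).mul_left_cancel
      -- Raising `m` needs the factor `q ^ j` of the second Pascal rule; raising `n` below needs the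
      -- `q ^ i` of the first.
      have key : ∀ p ∈ antidiagonal (m + 0), P p.1 * P p.2 *
          (q ^ p.2 * thetaCoeff q z w (m + 1) p.2 + thetaCoeff q z w (m + 1) (p.2 + 1)) =
          (1 - w * q ^ m) * (P p.1 * P p.2 * thetaCoeff q z w m p.2) := by
        intro p hp
        rw [thetaCoeff_succ_succ, thetaCoeff_shift_left hzw]
        ring
      simp only [add_zero, prod_range_zero] at ih key ⊢
      rw [h.sum_pascal', sum_congr rfl key, ← mul_sum, ih, prod_range_succ]
      rw [h.succ m]
      ring
  | succ n ih =>
    apply (h.isUnit_one_sub (m + n)).mul_left_cancel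
    have key : ∀ p ∈ antidiagonal (m + n), P p.1 * P p.2 *
        (thetaCoeff q z w m p.2 + q ^ p.1 * thetaCoeff q z w m (p.2 + 1)) =
        (1 - z * q ^ n) * (P p.1 * P p.2 * thetaCoeff q z w m p.2) := by
      intro p hp
      rw [thetaCoeff_shift_right hzw (mem_antidiagonal.1 hp)]
      ring
    rw [← add_assoc, h.sum_pascal, sum_congr rfl key, ← mul_sum, ih, prod_range_succ,
      h.succ (m + n)]
    ring

/-- The finite Jacobi triple product identity, with the terms paired. -/
theorem sum_theta_paired (h : IsQFactorialInv q P) {z w : R} (hzw : z * w = q) (n : ℕ) :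
    ∑ p ∈ antidiagonal n, (-1) ^ p.2 * (w ^ p.2 * q ^ p.2.choose 2 -
        z ^ (p.2 + 1) * q ^ (p.2 + 1).choose 2) * P p.1 * P (p.1 + 2 * p.2 + 1) =
      (∏ i ∈ range (n + 1), (1 - z * q ^ i)) * (∏ i ∈ range n, (1 - w * q ^ i)) *
        P (n + (n + 1)) := by
  rw [← h.sum_thetaCoeff hzw, sum_antidiagonal_eq_add_reflect]
  refine sum_congr rfl fun p hp => ?_
  rw [← mem_antidiagonal.1 hp]
  have h1 : thetaCoeff q z w (p.1 + p.2) p.1 = (-1) ^ p.2 * w ^ p.2 * q ^ p.2.choose 2 := by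
    rcases Nat.eq_zero_or_pos p.2 with h0 | h0
    · simp [h0, thetaCoeff]
    · rw [thetaCoeff, if_neg (by omega), Nat.add_sub_cancel_left]
  have h2 : thetaCoeff q z w (p.1 + p.2) (p.1 + 2 * p.2 + 1) =
      (-1) ^ (p.2 + 1) * z ^ (p.2 + 1) * q ^ (p.2 + 1).choose 2 := by
    rw [thetaCoeff, if_pos (by omega),
      show p.1 + 2 * p.2 + 1 - (p.1 + p.2) = p.2 + 1 by omega]
  simp only [h1, h2]
  ring

end IsQFactorialInv

/-! ### Bailey pairs and the Bailey chain -/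

theorem Finset.sum_antidiagonal_antidiagonal_assoc {M : Type*} [AddCommMonoid M]
    (f : ℕ → ℕ → ℕ → M) (n : ℕ) :
    ∑ p ∈ antidiagonal n, ∑ r ∈ antidiagonal p.2, f p.1 r.1 r.2 =
      ∑ p ∈ antidiagonal n, ∑ r ∈ antidiagonal p.1, f r.1 r.2 p.2 := by
  rw [sum_sigma', sum_sigma']
  refine sum_nbij' (fun x => ⟨(x.1.1 + x.2.1, x.2.2), (x.1.1, x.2.1)⟩)
    (fun x => ⟨(x.2.1, x.2.2 + x.1.2), (x.2.2, x.1.2)⟩) ?_ ?_ ?_ ?_ ?_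
  · rintro ⟨⟨a, b⟩, ⟨c, d⟩⟩ h
    simp only [mem_sigma, HasAntidiagonal.mem_antidiagonal] at h ⊢
    obtain ⟨rfl, rfl⟩ := h
    exact ⟨by ring, trivial⟩
  · rintro ⟨⟨a, b⟩, ⟨c, d⟩⟩ h
    simp only [mem_sigma, HasAntidiagonal.mem_antidiagonal] at h ⊢
    obtain ⟨rfl, rfl⟩ := h
    exact ⟨by ring, trivial⟩
  · rintro ⟨⟨a, b⟩, ⟨c, d⟩⟩ h
    simp only [mem_sigma, HasAntidiagonal.mem_antidiagonal] at h
    obtain ⟨-, rfl⟩ := h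
    rfl
  · rintro ⟨⟨a, b⟩, ⟨c, d⟩⟩ h
    simp only [mem_sigma, HasAntidiagonal.mem_antidiagonal] at h
    obtain ⟨-, rfl⟩ := h
    rfl
  · intro x _
    rfl

/-- The sequence `β` of the Bailey pair with parameter `a = q` that belongs to `α`. -/
def baileyBeta {R : Type*} [CommRing R] (P α : ℕ → R) (n : ℕ) : R :=
  ∑ p ∈ antidiagonal n, α p.2 * P p.1 * P (p.1 + 2 * p.2 + 1)

/-- The sequence `α` of the unit Bailey pair with parameter `a = q`. -/
def unitAlpha {R : Type*} [CommRing R] (q : R) (k : ℕ) : R :=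
  (-1) ^ k * (q ^ k.choose 2 - q ^ (k + 1) * q ^ (k + 1).choose 2)

namespace IsQFactorialInv

variable {R : Type*} [CommRing R] {q : R} {P : ℕ → R}

/-- Bailey's lemma. -/
theorem baileyBeta_mul (h : IsQFactorialInv q P) (α : ℕ → R) (n : ℕ) :
    baileyBeta P (fun k => q ^ (k ^ 2 + k) * α k) n =
      ∑ p ∈ antidiagonal n, q ^ (p.2 ^ 2 + p.2) * P p.1 * baileyBeta P α p.2 := by
  simp only [baileyBeta, mul_sum]
  have key : ∀ p ∈ antidiagonal n, ∑ r ∈ antidiagonal p.2,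
      q ^ (p.2 ^ 2 + p.2) * P p.1 * (α r.2 * P r.1 * P (r.1 + 2 * r.2 + 1)) =
      ∑ r ∈ antidiagonal p.2, (fun a i k => q ^ ((i + k) ^ 2 + (i + k)) * P a *
        (α k * P i * P (i + 2 * k + 1))) p.1 r.1 r.2 := by
    intro p _
    refine sum_congr rfl fun r hr => ?_
    simp only [mem_antidiagonal.1 hr]
  rw [sum_congr rfl key, sum_antidiagonal_antidiagonal_assoc (fun a i k =>
    q ^ ((i + k) ^ 2 + (i + k)) * P a * (α k * P i * P (i + 2 * k + 1)))]
  refine sum_congr rfl fun p _ => ?_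
  -- The inner sum is a Vandermonde sum with `c = 2k + 1`, as `(i+k)² + (i+k) = (k²+k) + i² +
  -- i(2k+1)`.
  have hv := h.vandermonde p.1 (2 * p.2 + 1)
  rw [mul_assoc, add_assoc, ← hv, mul_sum]
  refine sum_congr rfl fun r _ => ?_
  rw [← add_assoc]
  ring

theorem baileyBeta_unitAlpha (h : IsQFactorialInv q P) (n : ℕ) :
    baileyBeta P (unitAlpha q) n = if n = 0 then 1 else 0 := by
  have key := h.sum_theta_paired (mul_one q) n
  have : baileyBeta P (unitAlpha q) n = ∑ p ∈ antidiagonal n, (-1) ^ p.2 *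
      (1 ^ p.2 * q ^ p.2.choose 2 - q ^ (p.2 + 1) * q ^ (p.2 + 1).choose 2) *
        P p.1 * P (p.1 + 2 * p.2 + 1) := by
    simp [baileyBeta, unitAlpha]
  rw [this, key]
  clear this key
  rcases n with _ | n
  · have := h.succ 0
    rw [h.zero] at this
    simpa using this.symm
  -- With `w = 1` the factor of index `0` is `1 - 1 = 0`.
  · rw [if_neg n.succ_ne_zero, prod_range_succ' (fun i => 1 - 1 * q ^ i)]
    simp

theorem baileyBeta_one (h : IsQFactorialInv q P) (n : ℕ) :
    baileyBeta P (fun k => q ^ (k ^ 2 + k) * unitAlpha q k) n = P n := by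
  rw [h.baileyBeta_mul]
  rw [sum_eq_single (n, 0)]
  · simp [h.baileyBeta_unitAlpha]
  · intro p hp hne
    rw [h.baileyBeta_unitAlpha, if_neg, mul_zero]
    intro h0
    exact hne (Prod.ext (by simpa [h0] using mem_antidiagonal.1 hp) h0)
  · simp

end IsQFactorialInv

/-- The sum `∑ q^(j² + bj) / ((q)ᵢ (q)ⱼ)` over `i + j = n`. -/
def squareSum {R : Type*} [CommRing R] (q : R) (P : ℕ → R) (b n : ℕ) : R :=
  ∑ p ∈ antidiagonal n, P p.1 * P p.2 * q ^ (p.2 ^ 2 + b * p.2)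

namespace IsQFactorialInv

variable {R : Type*} [CommRing R] {q : R} {P : ℕ → R}

theorem baileyBeta_two (h : IsQFactorialInv q P) (n : ℕ) :
    baileyBeta P (fun k => q ^ (k ^ 2 + k) * (q ^ (k ^ 2 + k) * unitAlpha q k)) n =
      squareSum q P 1 n := by
  rw [h.baileyBeta_mul, squareSum]
  refine sum_congr rfl fun p _ => ?_
  rw [h.baileyBeta_one]
  ring

theorem baileyBeta_three (h : IsQFactorialInv q P) (n : ℕ) :
    baileyBeta P (fun k => q ^ (k ^ 2 + k) * (q ^ (k ^ 2 + k) * (q ^ (k ^ 2 + k) *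
      unitAlpha q k))) n =
      ∑ p ∈ antidiagonal n, q ^ (p.2 ^ 2 + p.2) * squareSum q P 1 p.2 * P p.1 := by
  rw [h.baileyBeta_mul]
  refine sum_congr rfl fun p _ => ?_
  rw [h.baileyBeta_two]
  ring

/-- Passing from `P n` to `P (n + 1)` changes it by a multiple of `q ^ (n + 1)`. This replaces the
limit `n → ∞` by congruences. -/
theorem pow_dvd_sub (h : IsQFactorialInv q P) (n k : ℕ) : q ^ (n + 1) ∣ P (n + k) - P n := by
  induction k with
  | zero => simp
  | succ k ih =>
    have : P (n + (k + 1)) - P n = q ^ (n + 1) * (q ^ k * P (n + (k + 1))) +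
        (P (n + k) - P n) := by
      rw [h.succ (n + k)]
      ring_nf
    rw [this]
    exact dvd_add (dvd_mul_right _ _) ih

/-- Orders add up: `a` contributes `p.2` and the difference of the two values of `P` contributes
`p.1 + 1`. -/
theorem dvd_mul_sub (h : IsQFactorialInv q P) {x a : R} (hx : x ∣ q) {p : ℕ × ℕ} {n : ℕ}
    (hp : p ∈ antidiagonal n) (ha : x ^ p.2 ∣ a) : x ^ (n + 1) ∣ a * P p.1 - a * P n := by
  rw [← mul_sub, ← mem_antidiagonal.1 hp, show p.1 + p.2 + 1 = p.2 + (p.1 + 1) by ring, pow_add]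
  exact mul_dvd_mul ha (dvd_sub_comm.1 ((pow_dvd_pow_of_dvd hx _).trans (h.pow_dvd_sub p.1 p.2)))

theorem dvd_sum_sub (h : IsQFactorialInv q P) {x : R} (hx : x ∣ q) {a : ℕ → R}
    (ha : ∀ k, x ^ k ∣ a k) (n : ℕ) :
    x ^ (n + 1) ∣ ∑ p ∈ antidiagonal n, a p.2 * P p.1 - P n * ∑ p ∈ antidiagonal n, a p.2 := by
  rw [mul_sum, ← sum_sub_distrib]
  refine dvd_sum fun p hp => ?_
  rw [mul_comm (P n)]
  exact h.dvd_mul_sub hx hp (ha _)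

theorem dvd_baileyBeta_sub (h : IsQFactorialInv q P) {x : R} (hx : x ∣ q) {α : ℕ → R}
    (hα : ∀ k, x ^ k ∣ α k) (n : ℕ) :
    x ^ (n + 1) ∣ baileyBeta P α n - P n ^ 2 * ∑ p ∈ antidiagonal n, α p.2 := by
  have h2 := (h.dvd_sum_sub hx hα n).mul_left (P n)
  have h1 : x ^ (n + 1) ∣ baileyBeta P α n - P n * ∑ p ∈ antidiagonal n, α p.2 * P p.1 := by
    rw [baileyBeta, mul_sum, ← sum_sub_distrib]
    refine dvd_sum fun p hp => ?_
    rw [mul_comm (P n), ← mul_sub]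
    refine ((pow_dvd_pow_of_dvd hx _).trans ?_).mul_left _
    rw [← mem_antidiagonal.1 hp, show p.1 + 2 * p.2 + 1 = p.1 + p.2 + (p.2 + 1) by ring]
    exact h.pow_dvd_sub _ _
  have := dvd_add h1 h2
  ring_nf at this ⊢
  exact this

/-- The sum side of the Andrews–Gordon identity modulo `7` as a truncated theta series. -/
theorem dvd_theta_sub_squareSum (h : IsQFactorialInv q P) (n : ℕ) :
    q ^ (n + 1) ∣ P n * ∑ p ∈ antidiagonal n, q ^ (3 * (p.2 ^ 2 + p.2)) * unitAlpha q p.2 -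
      ∑ p ∈ antidiagonal n, q ^ (p.2 ^ 2 + p.2) * squareSum q P 1 p.2 := by
  have hpow : ∀ k c : ℕ, ∀ y : R, q ^ k ∣ q ^ (k ^ 2 + k + c) * y := fun k c y =>
    (pow_dvd_pow q (by omega)).mul_right y
  have h1 := h.dvd_baileyBeta_sub dvd_rfl (α := fun k => q ^ (k ^ 2 + k) * (q ^ (k ^ 2 + k) *
    (q ^ (k ^ 2 + k) * unitAlpha q k))) (fun k => hpow k 0 _) n
  have h2 := h.dvd_sum_sub dvd_rfl (a := fun k => q ^ (k ^ 2 + k) * squareSum q P 1 k)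
    (fun k => hpow k 0 _) n
  rw [h.baileyBeta_three] at h1
  have h3 := dvd_sub h2 h1
  -- The same `β` is congruent to `P n ^ 2` times the theta sum and to `P n` times the double sum;
  -- one unit `P n` cancels.
  refine ((h.isUnit n).dvd_mul_left).1 ?_
  convert h3 using 1
  have : ∀ k : ℕ, q ^ (3 * (k ^ 2 + k)) * unitAlpha q k = q ^ (k ^ 2 + k) * (q ^ (k ^ 2 + k) *
    (q ^ (k ^ 2 + k) * unitAlpha q k)) := fun k => by ring
  simp only [this]
  ring

/-- A truncated theta series as a truncated infinite product. -/
theorem dvd_theta_sub_prod (h : IsQFactorialInv q P) {x z w : R} (hzw : z * w = q) (hz : x ∣ z)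
    (hw : x ∣ w) (n : ℕ) :
    x ^ (n + 1) ∣ ∑ p ∈ antidiagonal n, (-1) ^ p.2 * (w ^ p.2 * q ^ p.2.choose 2 -
        z ^ (p.2 + 1) * q ^ (p.2 + 1).choose 2) -
      (∏ i ∈ range (n + 1), (1 - z * q ^ i)) * (∏ i ∈ range n, (1 - w * q ^ i)) *
        ∏ i ∈ range n, (1 - q ^ (i + 1)) := by
  have hx : x ∣ q := hzw ▸ hz.mul_right w
  have h1 := h.dvd_baileyBeta_sub hx (α := fun k => (-1) ^ k * (w ^ k * q ^ k.choose 2 -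
        z ^ (k + 1) * q ^ (k + 1).choose 2)) (fun k => ((dvd_sub
          ((pow_dvd_pow_of_dvd hw k).mul_right _)
          (((pow_dvd_pow x k.le_succ).trans (pow_dvd_pow_of_dvd hz (k + 1))).mul_right _)).mul_left
            _)) n
  rw [baileyBeta, h.sum_theta_paired hzw] at h1
  have h2 := ((pow_dvd_pow_of_dvd hx _).trans (h.pow_dvd_sub n (n + 1))).mul_left
    ((∏ i ∈ range (n + 1), (1 - z * q ^ i)) * (∏ i ∈ range n, (1 - w * q ^ i)))
  refine (((h.isUnit n).pow 2).dvd_mul_left).1 ?_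
  convert dvd_sub h2 h1 using 1
  have := h.prod_mul n
  linear_combination (-(∏ i ∈ range (n + 1), (1 - z * q ^ i)) *
    (∏ i ∈ range n, (1 - w * q ^ i)) * P n) * this

end IsQFactorialInv

/-! ### The product side and the Andrews–Gordon identity -/

open PowerSeries
open scoped PowerSeries.WithPiTopology

theorem PowerSeries.isUnit_one_sub_of_constantCoeff {R : Type*} [CommRing R] {q : R⟦X⟧}
    (hq : constantCoeff q = 0) : IsUnit (1 - q) := by
  rw [PowerSeries.isUnit_iff_constantCoeff]
  simp [hq]

/-- The inverse of the `q`-factorial in a power series ring. -/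
noncomputable def qFactorialInv (q : ℤ⟦X⟧) (n : ℕ) : ℤ⟦X⟧ :=
  ∏ i ∈ range n, Ring.inverse (1 - q ^ (i + 1))

theorem PowerSeries.one_sub_mul_inverse {q : ℤ⟦X⟧} (hq : constantCoeff q = 0) (i : ℕ) :
    (1 - q ^ (i + 1)) * Ring.inverse (1 - q ^ (i + 1)) = 1 :=
  Ring.mul_inverse_cancel _ (isUnit_one_sub_of_constantCoeff (by simp [hq]))

theorem isQFactorialInv_qFactorialInv {q : ℤ⟦X⟧} (hq : constantCoeff q = 0) :
    IsQFactorialInv q (qFactorialInv q) where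
  zero := by simp [qFactorialInv]
  succ n := by
    rw [qFactorialInv, qFactorialInv, prod_range_succ]
    linear_combination (-∏ i ∈ range n, Ring.inverse (1 - q ^ (i + 1))) * one_sub_mul_inverse hq n

/-- The parts that are allowed in the partitions counted by `numPartitionsModSeven`. -/
def IsAllowedPart (p : ℕ) : Prop :=
  ¬ (p : ℤ) ≡ 0 [ZMOD 7] ∧ ¬ (p : ℤ) ≡ 1 [ZMOD 7] ∧ ¬ (p : ℤ) ≡ -1 [ZMOD 7]

instance : DecidablePred IsAllowedPart := fun p => by
  unfold IsAllowedPart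
  infer_instance

theorem isAllowedPart_iff (p : ℕ) : IsAllowedPart p ↔ p % 7 ≠ 0 ∧ p % 7 ≠ 1 ∧ p % 7 ≠ 6 := by
  simp only [IsAllowedPart, Int.ModEq]
  omega

/-- In each block `7n + 1, …, 7n + 7`, the triple product cancels exactly the factors of `7n + 1`,
`7n + 6` and `7n + 7`. -/
theorem qFactorialInv_mul_prod (n : ℕ) :
    qFactorialInv X (7 * n) * ((∏ i ∈ range n, (1 - X * (X ^ 7) ^ i)) *
      (∏ i ∈ range n, (1 - X ^ 6 * (X ^ 7) ^ i)) * ∏ i ∈ range n, (1 - (X ^ 7) ^ (i + 1))) =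
    ∏ i ∈ range (7 * n), if IsAllowedPart (i + 1) then Ring.inverse (1 - X ^ (i + 1) : ℤ⟦X⟧)
      else 1 := by
  induction n with
  | zero => simp [qFactorialInv]
  | succ n ih =>
    have hX : constantCoeff (X : ℤ⟦X⟧) = 0 := by simp
    have h0 := one_sub_mul_inverse hX (7 * n)
    have h5 := one_sub_mul_inverse hX (7 * n + 5)
    have h6 := one_sub_mul_inverse hX (7 * n + 6)
    rw [qFactorialInv] at ih ⊢
    rw [show 7 * (n + 1) = 7 * n + 1 + 1 + 1 + 1 + 1 + 1 + 1 by ring]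
    simp only [prod_range_succ]
    rw [← ih]
    rw [if_neg (by rw [isAllowedPart_iff]; omega), if_pos (by rw [isAllowedPart_iff]; omega),
      if_pos (by rw [isAllowedPart_iff]; omega), if_pos (by rw [isAllowedPart_iff]; omega),
      if_pos (by rw [isAllowedPart_iff]; omega), if_neg (by rw [isAllowedPart_iff]; omega),
      if_neg (by rw [isAllowedPart_iff]; omega)]
    have e0 : (X : ℤ⟦X⟧) * (X ^ 7) ^ n = X ^ (7 * n + 1) := by ring
    have e5 : (X : ℤ⟦X⟧) ^ 6 * (X ^ 7) ^ n = X ^ (7 * n + 5 + 1) := by ring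
    have e6 : ((X : ℤ⟦X⟧) ^ 7) ^ (n + 1) = X ^ (7 * n + 6 + 1) := by ring
    simp only [e0, e5, e6, add_assoc, Nat.reduceAdd] at h0 h5 h6 ⊢
    generalize (∏ i ∈ range (7 * n), Ring.inverse (1 - (X : ℤ⟦X⟧) ^ (i + 1))) = A
    generalize (∏ i ∈ range n, (1 - (X : ℤ⟦X⟧) * (X ^ 7) ^ i)) = B1
    generalize (∏ i ∈ range n, (1 - (X : ℤ⟦X⟧) ^ 6 * (X ^ 7) ^ i)) = B2
    generalize (∏ i ∈ range n, (1 - ((X : ℤ⟦X⟧) ^ 7) ^ (i + 1))) = B3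
    generalize (X : ℤ⟦X⟧) ^ (7 * n + 1) = x0 at *
    generalize (X : ℤ⟦X⟧) ^ (7 * n + 6) = x5 at *
    generalize (X : ℤ⟦X⟧) ^ (7 * n + 7) = x6 at *
    generalize Ring.inverse (1 - x0) = y0 at *
    generalize Ring.inverse (1 - x5) = y5 at *
    generalize Ring.inverse (1 - x6) = y6 at *
    generalize Ring.inverse (1 - (X : ℤ⟦X⟧) ^ _) = y1
    generalize Ring.inverse (1 - (X : ℤ⟦X⟧) ^ _) = y2
    generalize Ring.inverse (1 - (X : ℤ⟦X⟧) ^ _) = y3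
    generalize Ring.inverse (1 - (X : ℤ⟦X⟧) ^ _) = y4
    calc _ = A * (B1 * B2 * B3) * (y1 * y2 * y3 * y4) * ((1 - x0) * y0) * ((1 - x5) * y5) *
        ((1 - x6) * y6) := by ring
      _ = _ := by rw [h0, h5, h6]; ring

/-- The generating function of the partitions into parts `≢ 0, ±1 (mod 7)`. -/
theorem eventually_coeff_prod_allowed (n : ℕ) :
    ∀ᶠ N in Filter.atTop, coeff n (∏ i ∈ range N, if IsAllowedPart (i + 1) then
      Ring.inverse (1 - X ^ (i + 1) : ℤ⟦X⟧) else 1) = numPartitionsModSeven n := by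
  -- In the discrete topology, convergence of a coefficient means that it is eventually constant.
  let _ : TopologicalSpace ℤ := ⊥
  have _ : DiscreteTopology ℤ := ⟨rfl⟩
  have h := (Nat.Partition.hasProd_powerSeriesMk_card_restricted ℤ IsAllowedPart).tendsto_prod_nat
  rw [PowerSeries.WithPiTopology.tendsto_iff_coeff_tendsto] at h
  have h' := h n
  rw [nhds_discrete, Filter.tendsto_pure] at h'
  filter_upwards [h'] with N hN
  rw [coeff_mk] at hN
  have hc : ((Nat.Partition.restricted n IsAllowedPart).card : ℤ) = numPartitionsModSeven n := rfl
  rw [← hc, ← hN]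
  congr 1
  refine prod_congr rfl fun i _ => ?_
  split_ifs
  · have h1 := PowerSeries.WithPiTopology.tsum_pow_mul_one_sub_of_constantCoeff_eq_zero
      (f := (X : ℤ⟦X⟧) ^ (i + 1)) (by simp)
    simp only [pow_mul]
    have h2 := one_sub_mul_inverse (q := X) (by simp) i
    linear_combination (-Ring.inverse (1 - (X : ℤ⟦X⟧) ^ (i + 1))) * h1 +
      (∑' j : ℕ, ((X : ℤ⟦X⟧) ^ (i + 1)) ^ j) * h2
  · rfl

/-- Andrews–Gordon identity modulo `7`. -/
theorem numPartitionsModSeven_eq_coeff (n : ℕ) :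
    ∀ᶠ N in Filter.atTop, (numPartitionsModSeven n : ℤ) =
      coeff n (∑ s ∈ range (N + 1), X ^ (s ^ 2 + s) * squareSum X (qFactorialInv X) 1 s) := by
  obtain ⟨K, hK⟩ := Filter.eventually_atTop.1 (eventually_coeff_prod_allowed n)
  filter_upwards [Filter.eventually_ge_atTop K, Filter.eventually_ge_atTop n] with N hN hn
  have h := isQFactorialInv_qFactorialInv (q := X) (by simp)
  have h7 := isQFactorialInv_qFactorialInv (q := X ^ 7) (by simp)
  rw [← hK (7 * N) (by omega), ← qFactorialInv_mul_prod]
  set A := qFactorialInv X (7 * N) with hA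
  set B1 := ∏ i ∈ range N, (1 - X * (X ^ 7) ^ i : ℤ⟦X⟧)
  set B2 := ∏ i ∈ range N, (1 - X ^ 6 * (X ^ 7) ^ i : ℤ⟦X⟧)
  set B3 := ∏ i ∈ range N, (1 - (X ^ 7) ^ (i + 1) : ℤ⟦X⟧)
  set T := ∑ p ∈ antidiagonal N, (X : ℤ⟦X⟧) ^ (p.2 ^ 2 + p.2) *
    squareSum X (qFactorialInv X) 1 p.2
  have hT : ∑ s ∈ range (N + 1), (X : ℤ⟦X⟧) ^ (s ^ 2 + s) *
      squareSum X (qFactorialInv X) 1 s = T := by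
    rw [← Finset.Nat.sum_antidiagonal_eq_sum_range_succ (fun s _ => (X : ℤ⟦X⟧) ^ (s ^ 2 + s) *
      squareSum X (qFactorialInv X) 1 s) N, ← Finset.Nat.sum_antidiagonal_swap]
    rfl
  have h1 := h.dvd_theta_sub_squareSum N
  have h2 := h7.dvd_theta_sub_prod (x := X) (z := X) (w := X ^ 6) (by ring) dvd_rfl
    (dvd_pow_self X (by norm_num)) N
  -- The modulus `7` arises here: three factors `q^(k²+k)` turn the exponent `k(k-1)/2` of the unit
  -- pair into `7k(k-1)/2 + 6k`.
  have hθ : ∀ k : ℕ, (-1) ^ k * ((X ^ 6) ^ k * (X ^ 7) ^ k.choose 2 -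
      X ^ (k + 1) * (X ^ 7) ^ (k + 1).choose 2) =
      X ^ (3 * (k ^ 2 + k)) * unitAlpha (X : ℤ⟦X⟧) k := by
    intro k
    have h2 : 2 * k.choose 2 + k = k ^ 2 := by
      have h3 := Nat.choose_two_right k
      rcases k with _ | k
      · rfl
      · have h4 := Nat.div_mul_cancel (Nat.even_mul_pred_self (k + 1)).two_dvd
        rw [← h3] at h4
        simp only [Nat.add_sub_cancel] at h4
        nlinarith
    have e1 : 6 * k + 7 * k.choose 2 = 3 * (k ^ 2 + k) + k.choose 2 := by omega
    have e2 : k + 1 + 7 * (k + k.choose 2) = 3 * (k ^ 2 + k) + (k + 1 + (k + k.choose 2)) := by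
      omega
    rw [unitAlpha, Nat.choose_succ_succ' k 1, Nat.choose_one_right, ← pow_mul, ← pow_mul,
      ← pow_mul, ← pow_add, ← pow_add, e1, e2, pow_add, pow_add _ (3 * (k ^ 2 + k))]
    ring
  simp only [hθ] at h2
  rw [prod_range_succ] at h2
  have h3 : (X : ℤ⟦X⟧) ^ (N + 1) ∣ A - qFactorialInv X N := by
    have := h.pow_dvd_sub N (6 * N)
    rwa [show N + 6 * N = 7 * N by ring] at this
  -- The `z`-product has one factor more than the others; it is `1` to this order.
  have h4 : (X : ℤ⟦X⟧) ^ (N + 1) ∣ X * (X ^ 7) ^ N := by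
    rw [← pow_mul, ← pow_succ']
    exact pow_dvd_pow _ (by omega)
  have h5 : (X : ℤ⟦X⟧) ^ (N + 1) ∣ A * (B1 * B2 * B3) - T := by
    have := (((h3.mul_left (B1 * B2 * B3)).add h1).sub (h2.mul_left (qFactorialInv X N))).add
      (h4.mul_left (qFactorialInv X N * B1 * B2 * B3))
    convert this using 1
    ring
  rw [hT, ← sub_eq_zero, ← map_sub]
  exact (PowerSeries.X_pow_dvd_iff.1 h5) n (by omega)

/-! ### String weights as Fibonacci counts -/

/-- Fibonacci weights of a list of integers with gaps at least `2`, cut into runs of gap `2`: the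
number of sets of runs, no two of them separated by a gap `3`, that do not contain (first
component), respectively contain (second component), the first run. -/
def runWeights : List ℕ → ℕ × ℕ
  | [] => (1, 0)
  | [_] => (1, 1)
  | a :: b :: l =>
    if b ≤ a + 2 then runWeights (b :: l)
    else if b ≤ a + 3 then
      ((runWeights (b :: l)).1 + (runWeights (b :: l)).2, (runWeights (b :: l)).1)
    else ((runWeights (b :: l)).1 + (runWeights (b :: l)).2,
      (runWeights (b :: l)).1 + (runWeights (b :: l)).2)

theorem List.splitBy_cons_cons_of_pos {α : Type*} {r : α → α → Bool} {a b : α} {l ψ : List α}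
    {ψs : List (List α)} (h : (b :: l).splitBy r = (b :: ψ) :: ψs) (hab : r a b = true) :
    (a :: b :: l).splitBy r = (a :: b :: ψ) :: ψs := by
  rw [List.splitBy_eq_iff] at h ⊢
  obtain ⟨h1, h2, h3, h4⟩ := h
  refine ⟨by rw [h1]; simp, by simpa using h2, ?_, ?_⟩
  · intro m hm
    rcases List.mem_cons.1 hm with rfl | hm
    · exact List.isChain_cons_cons.2 ⟨hab, h3 _ (by simp)⟩
    · exact h3 m (by simp [hm])
  · cases ψs with
    | nil => simp
    | cons c ψs =>
      rw [List.isChain_cons_cons] at h4 ⊢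
      obtain ⟨⟨_, hc, h⟩, h'⟩ := h4
      exact ⟨⟨by simp, hc, by simpa using h⟩, h'⟩

theorem List.splitBy_cons_cons_of_neg {α : Type*} {r : α → α → Bool} {a b : α} {l : List α}
    (hab : r a b = false) :
    (a :: b :: l).splitBy r = [a] :: (b :: l).splitBy r := by
  have := List.splitBy_append_cons (r := r) (l := [a]) (a := b) l (by simpa using hab)
  simpa [List.splitBy_of_isChain] using this

theorem gapsThree_cons_cons (a b : ℕ) (l : List ℕ) :
    gapsThree (a :: b :: l) = gapsThree (b :: l) + if b = a + 3 then 1 else 0 := by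
  simp [gapsThree, List.countP_cons]

theorem stringWeight_of_four_le {ψ : List ℕ} (h : ∀ p ∈ ψ, 4 ≤ p) :
    stringWeight ψ = Nat.fib (gapsThree ψ + 3) := if_pos h

/-- The decomposition of a Rogers–Ramanujan list into strings, with its weights. -/
theorem splitBy_structure (a : ℕ) (l : List ℕ) (ha : 1 ≤ a)
    (h : (a :: l).IsChain fun a b => a + 2 ≤ b) :
    ∃ ψ ψs, (a :: l).splitBy (fun a b => decide (b ≤ a + 3)) = (a :: ψ) :: ψs ∧
      (∀ p ∈ ψ, a + 2 ≤ p) ∧ (∀ s ∈ ψs, ∀ p ∈ s, a + 4 ≤ p) ∧ (∀ b ∈ ψ.head?, b ≤ a + 3) ∧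
      (runWeights (a :: l)).1 =
        Nat.fib (gapsThree (a :: ψ) + 2) * (ψs.map stringWeight).prod ∧
      (runWeights (a :: l)).2 =
        Nat.fib (gapsThree (a :: ψ) + 1) * (ψs.map stringWeight).prod := by
  induction l generalizing a with
  | nil => exact ⟨[], [], by simp [List.splitBy_of_isChain], by simp, by simp, by simp,
      by simp [runWeights, gapsThree], by simp [runWeights, gapsThree]⟩
  | cons b l ih =>
    rw [List.isChain_cons_cons] at h
    obtain ⟨hab, hl⟩ := h
    obtain ⟨ψ, ψs, h1, h2, h3, h4, h5, h6⟩ := ih b (by omega) hl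
    by_cases hb : b ≤ a + 3
    · refine ⟨b :: ψ, ψs, List.splitBy_cons_cons_of_pos h1 (by simpa using hb), ?_, ?_, ?_, ?_⟩
      · intro p hp
        rcases List.mem_cons.1 hp with rfl | hp
        · exact hab
        · have := h2 p hp
          omega
      · intro s hs p hp
        have := h3 s hs p hp
        omega
      · simpa using hb
      · rw [gapsThree_cons_cons, runWeights]
        by_cases hb2 : b ≤ a + 2
        · rw [if_pos hb2, if_neg (by omega), h5, h6]
          exact ⟨rfl, rfl⟩
        · rw [if_neg hb2, if_pos hb, if_pos (by omega), h5, h6]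
          refine ⟨?_, rfl⟩
          rw [Nat.fib_add_two (n := gapsThree (b :: ψ) + 1)]
          ring
    · have hbψ : ∀ p ∈ b :: ψ, a + 4 ≤ p := by
        intro p hp
        rcases List.mem_cons.1 hp with rfl | hp
        · omega
        · have := h2 p hp
          omega
      -- A string after the first has all parts at least `4`, so its weight is the unrestricted
      -- count, the sum of both components.
      have hw : stringWeight (b :: ψ) = Nat.fib (gapsThree (b :: ψ) + 1) +
          Nat.fib (gapsThree (b :: ψ) + 2) := by
        rw [stringWeight_of_four_le fun p hp => by have := hbψ p hp; omega, ← Nat.fib_add_two]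
      refine ⟨[], (b :: ψ) :: ψs, ?_, by simp, ?_, by simp, ?_⟩
      · rw [List.splitBy_cons_cons_of_neg (by simpa using hb), h1]
      · intro s hs p hp
        rcases List.mem_cons.1 hs with rfl | hs
        · exact hbψ p hp
        · have := h3 s hs p hp
          omega
      · rw [runWeights, if_neg (by omega), if_neg hb, h5, h6]
        simp [gapsThree, hw]
        ring

/-- The product of the weights of the strings of a list. -/
def listWeight (l : List ℕ) : ℕ :=
  ((l.splitBy (fun a b => decide (b ≤ a + 3))).map stringWeight).prod

/-- A first string through `2` either continues with `4` or `5`, with weight `F_{η+1}`, or is `[2]`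
alone; there the prescribed `F_{η+2} = F₂` equals `F_{η+1} = F₁`. -/
theorem listWeight_two_cons {l : List ℕ} (h : (2 :: l).IsChain fun a b => a + 2 ≤ b) :
    listWeight (2 :: l) = (runWeights (2 :: l)).2 := by
  obtain ⟨ψ, ψs, h1, h2, h3, h4, h5, h6⟩ := splitBy_structure 2 l (by norm_num) h
  rw [h6, listWeight, h1, List.map_cons, List.prod_cons]
  congr 1
  have h3' : 3 ∉ ψ := fun h => absurd (h2 3 h) (by norm_num)
  rcases ψ with _ | ⟨b, ψ⟩
  · simp [stringWeight, gapsThree]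
  · have hb : b = 4 ∨ b = 5 := by
      have := h2 b (by simp)
      have := h4 b (by simp)
      omega
    rw [stringWeight, if_neg (by simp), if_neg, if_pos]
    · rcases hb with rfl | rfl <;> simp
    · rcases hb with rfl | rfl <;> simp at h3' ⊢ <;> exact h3'

theorem listWeight_three_cons {l : List ℕ} (h : (3 :: l).IsChain fun a b => a + 2 ≤ b) :
    listWeight (3 :: l) = (runWeights (3 :: l)).1 := by
  obtain ⟨ψ, ψs, h1, h2, h3, h4, h5, h6⟩ := splitBy_structure 3 l (by norm_num) h
  rw [h5, listWeight, h1, List.map_cons, List.prod_cons, stringWeight, if_neg (by simp),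
    if_pos (by simp)]

theorem listWeight_cons_of_four_le {a : ℕ} {l : List ℕ} (ha : 4 ≤ a)
    (h : (a :: l).IsChain fun a b => a + 2 ≤ b) :
    listWeight (a :: l) = (runWeights (a :: l)).1 + (runWeights (a :: l)).2 := by
  obtain ⟨ψ, ψs, h1, h2, h3, h4, h5, h6⟩ := splitBy_structure a l (by omega) h
  rw [h5, h6, listWeight, h1, List.map_cons, List.prod_cons, stringWeight_of_four_le,
    ← add_mul, add_comm (Nat.fib _), ← Nat.fib_add_two]
  intro p hp
  rcases List.mem_cons.1 hp with rfl | hp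
  · exact ha
  · have := h2 p hp
    omega

/-! ### Lists with given length, smallest part and sum -/

/-- The lists of `N + 1` integers with smallest element `a`, consecutive differences at least `2`,
and sum `n`. -/
def rrLists : ℕ → ℕ → ℕ → Finset (List ℕ)
  | 0, a, n => if n = a then {[a]} else ∅
  | N + 1, a, n => if a ≤ n then
      ((range (n + 2)).biUnion fun d => rrLists N (a + 2 + d) (n - a)).image (List.cons a) else ∅

theorem mem_rrLists {N a n : ℕ} {l : List ℕ} :
    l ∈ rrLists N a n ↔ l.length = N + 1 ∧ l.head? = some a ∧
      l.IsChain (fun a b => a + 2 ≤ b) ∧ l.sum = n := by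
  induction N generalizing a n l with
  | zero =>
    rw [rrLists]
    rcases l with _ | ⟨b, _ | ⟨c, l⟩⟩
    · split_ifs <;> simp
    · split_ifs with h
      · simp; rintro rfl; exact h.symm
      · simp; rintro rfl; exact fun h' => h h'.symm
    · split_ifs <;> simp
  | succ N ih =>
    rw [rrLists]
    split_ifs with h
    · simp only [mem_image, mem_biUnion, mem_range, ih]
      constructor
      · rintro ⟨l, ⟨d, hd, h1, h2, h3, h4⟩, rfl⟩
        rcases l with _ | ⟨b, l⟩
        · simp at h1
        · simp only [List.head?_cons, Option.some.injEq] at h2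
          simp only [List.length_cons, List.head?_cons, List.isChain_cons_cons, List.sum_cons,
            true_and] at *
          exact ⟨by omega, ⟨by omega, h3⟩, by omega⟩
      · rintro ⟨h1, h2, h3, h4⟩
        rcases l with _ | ⟨b, _ | ⟨c, l⟩⟩
        · simp at h1
        · simp at h1
        · simp only [List.length_cons, List.head?_cons, List.isChain_cons_cons, List.sum_cons,
            Option.some.injEq] at *
          subst h2
          refine ⟨c :: l, ⟨c - (b + 2), by omega, ?_, ?_, h3.2, ?_⟩, rfl⟩
          · simp; omega
          · simp; omega
          · simp; omega
    · simp only [notMem_empty, false_iff]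
      rintro ⟨h1, h2, h3, rfl⟩
      rcases l with _ | ⟨b, l⟩
      · simp at h1
      · simp at h2 h
        omega

theorem pairwiseDisjoint_rrLists (N n : ℕ) (s : Set ℕ) :
    s.PairwiseDisjoint fun a => rrLists N a n := by
  intro a _ b _ hab
  rw [Function.onFun, disjoint_left]
  intro l h1 h2
  rw [mem_rrLists] at h1 h2
  exact hab (Option.some.inj (h1.2.1.symm.trans h2.2.1))

theorem sum_rrLists_succ {M : Type*} [AddCommMonoid M] (f : List ℕ → M) (N a n : ℕ) (h : a ≤ n) :
    ∑ l ∈ rrLists (N + 1) a n, f l =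
      ∑ d ∈ range (n + 2), ∑ l ∈ rrLists N (a + 2 + d) (n - a), f (a :: l) := by
  rw [rrLists, if_pos h, sum_image (by simp), sum_biUnion]
  intro d _ e _ hde
  exact pairwiseDisjoint_rrLists N (n - a) Set.univ (Set.mem_univ _) (Set.mem_univ _)
    (by omega)

/-! ### Recurrences and generating functions -/

/-- The sum `∑ q^(j² - j) / ((q)ᵢ (q)ⱼ)` over `i + j = n`. -/
def squareSumNeg {R : Type*} [CommRing R] (q : R) (P : ℕ → R) (n : ℕ) : R :=
  ∑ p ∈ antidiagonal n, P p.1 * P p.2 * q ^ (p.2 * (p.2 - 1))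

theorem pow_mul_pow_mul_pred {R : Type*} [CommRing R] (q : R) (j : ℕ) :
    q ^ j * q ^ (j * (j - 1)) = q ^ (j ^ 2) := by
  rw [← pow_add]
  congr 1
  rcases j with _ | j
  · rfl
  · simp only [Nat.add_sub_cancel]
    ring

namespace IsQFactorialInv

variable {R : Type*} [CommRing R] {q : R} {P : ℕ → R}

/-- `squareSumNeg` serves to sum over all smallest parts: raising every one of `n + 1` parts by `1`
multiplies by `q ^ (n + 1)`, and this relation sums the resulting geometric series. -/
theorem one_sub_mul_squareSumNeg (h : IsQFactorialInv q P) (n : ℕ) :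
    (1 - q ^ (n + 1)) * squareSumNeg q P (n + 1) = squareSum q P 0 n + squareSum q P 1 n := by
  rw [squareSumNeg, h.sum_pascal' (fun j => q ^ (j * (j - 1))), squareSum, squareSum,
    ← sum_add_distrib]
  refine sum_congr rfl fun p _ => ?_
  rw [pow_mul_pow_mul_pred]
  simp only [Nat.add_sub_cancel]
  ring

/-- Split `1 = (1 - q ^ i) + q ^ i` and use `i + j² = (i + j) + j(j-1)`. -/
theorem squareSum_zero_succ (h : IsQFactorialInv q P) (n : ℕ) :
    squareSum q P 0 (n + 1) = squareSum q P 0 n + q ^ (n + 1) * squareSumNeg q P (n + 1) := by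
  have h1 := h.sum_fst (fun _ j => q ^ (j ^ 2 + 0 * j)) n
  rw [squareSum, squareSum, ← h1, squareSumNeg, mul_sum, ← sum_add_distrib]
  refine sum_congr rfl fun p hp => ?_
  have := pow_mul_pow_mul_pred q p.2
  rw [← HasAntidiagonal.mem_antidiagonal.1 hp, pow_add q p.1]
  linear_combination (-P p.1 * P p.2 * q ^ p.1) * this

theorem squareSum_zero_sub (h : IsQFactorialInv q P) (n : ℕ) :
    squareSum q P 0 n - q * squareSum q P 2 n = (1 - q ^ (n + 1)) * squareSum q P 1 n := by
  rcases n with _ | n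
  · simp [squareSum, h.zero]
  · have h1 := h.sum_snd (fun _ j => q ^ (j ^ 2)) n
    have h2 := h.sum_fst (fun _ j => q ^ ((j + 1) ^ 2)) n
    rw [← h2] at h1
    simp only [squareSum, mul_sum]
    rw [← sub_eq_zero, ← sum_sub_distrib, ← sum_sub_distrib]
    rw [← sub_eq_zero, ← sum_sub_distrib] at h1
    rw [← h1]
    refine sum_congr rfl fun p hp => ?_
    rw [← HasAntidiagonal.mem_antidiagonal.1 hp]
    ring

theorem squareSum_one_succ (h : IsQFactorialInv q P) (n : ℕ) :
    squareSum q P 1 (n + 1) =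
      q ^ (n + 1) * squareSumNeg q P (n + 1) + (1 - q ^ (n + 1)) * squareSum q P 1 n := by
  have h1 := h.sum_fst (fun _ j => q ^ (j ^ 2 + 0 * j)) n
  have h2 := h.sum_snd (fun _ j => q ^ (j ^ 2)) n
  have h3 : ∑ p ∈ antidiagonal n, P p.1 * P p.2 * q ^ ((p.2 + 1) ^ 2) =
      q * squareSum q P 2 n := by
    rw [squareSum, mul_sum]
    refine sum_congr rfl fun p _ => ?_
    ring
  rw [h3] at h2
  rw [← h.squareSum_zero_sub, ← h2, squareSum.eq_1 q P 0, ← h1, squareSum, squareSumNeg, mul_sum,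
    ← sum_sub_distrib, ← sum_add_distrib]
  refine sum_congr rfl fun p hp => ?_
  have := pow_mul_pow_mul_pred q p.2
  rw [← HasAntidiagonal.mem_antidiagonal.1 hp, pow_add q p.1]
  linear_combination (-P p.1 * P p.2 * q ^ p.1) * this

end IsQFactorialInv

/-- A geometric series truncated after `n` terms: the omitted tail starts in degree at least `A +
n`. -/
theorem coeff_sum_pow_mul {R : Type*} [CommRing R] {N A n m : ℕ} {y e : R⟦X⟧}
    (h : (1 - X ^ (N + 1)) * e = y) (hm : m < A + n) :
    coeff m (∑ d ∈ range n, X ^ ((N + 1) * (A + d)) * y) =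
      coeff m (X ^ ((N + 1) * A) * e) := by
  have h1 : ∑ d ∈ range n, X ^ ((N + 1) * (A + d)) * y =
      X ^ ((N + 1) * A) * e - X ^ ((N + 1) * (A + n)) * e := by
    have hg := geom_sum_mul_neg ((X : R⟦X⟧) ^ (N + 1)) n
    have h2 : ∑ d ∈ range n, X ^ ((N + 1) * (A + d)) * y =
        X ^ ((N + 1) * A) * ((∑ d ∈ range n, (X ^ (N + 1)) ^ d) * y) := by
      rw [sum_mul, mul_sum]
      refine sum_congr rfl fun d _ => ?_
      ring
    rw [h2, ← h, ← mul_assoc (∑ d ∈ range n, _), hg]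
    ring
  rw [h1, map_sub, sub_eq_self, coeff_X_pow_mul', if_neg]
  nlinarith

section

variable {P : ℕ → ℤ⟦X⟧}

/-- The generating functions of Rogers–Ramanujan lists with prescribed length and smallest
element, weighted by `runWeights`. -/
theorem sum_runWeights (h : IsQFactorialInv X P) (N a n : ℕ) :
    ∑ l ∈ rrLists N (a + 1) n, ((runWeights l).1 : ℤ) =
      coeff n (X ^ ((N + 1) * a) * (X ^ ((N + 1) ^ 2) * squareSum X P 0 N)) ∧
    ∑ l ∈ rrLists N (a + 1) n, ((runWeights l).2 : ℤ) =
      coeff n (X ^ ((N + 1) * a) * (X ^ ((N + 1) ^ 2) * squareSum X P 1 N)) := by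
  induction N generalizing a n with
  | zero =>
    have : ∀ b, squareSum X P b 0 = 1 := by simp [squareSum, h.zero]
    rw [this, this, rrLists]
    simp only [mul_one, ← pow_add, coeff_X_pow]
    split_ifs <;> simp_all [runWeights]
  | succ N ih =>
    -- `u` and `c` belong to lists of `N + 1` parts starting at `1`, for the two components; `e`
    -- collects both components over all starting values `≥ 1`. In `h1` and `h2` the three summands
    -- are the next gaps `2`, `3` and `≥ 4`.
    set u := (X : ℤ⟦X⟧) ^ ((N + 1) ^ 2) * squareSum X P 0 N with hu
    set c := (X : ℤ⟦X⟧) ^ ((N + 1) ^ 2) * squareSum X P 1 N with hc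
    set e := (X : ℤ⟦X⟧) ^ ((N + 1) ^ 2) * squareSumNeg X P (N + 1) with he
    have hrel : (1 - X ^ (N + 1)) * e = u + c := by
      rw [hu, hc, he]
      linear_combination (X ^ ((N + 1) ^ 2)) * h.one_sub_mul_squareSumNeg N
    have h1 : (X : ℤ⟦X⟧) ^ ((N + 1 + 1) * a) * (X ^ ((N + 1 + 1) ^ 2) *
        squareSum X P 0 (N + 1)) = X ^ (a + 1) * (X ^ ((N + 1) * (a + 2)) * u +
          X ^ ((N + 1) * (a + 3)) * (u + c) + X ^ ((N + 1) * (a + 4)) * e) := by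
      rw [← hrel, h.squareSum_zero_succ, hu, he]
      ring
    have h2 : (X : ℤ⟦X⟧) ^ ((N + 1 + 1) * a) * (X ^ ((N + 1 + 1) ^ 2) *
        squareSum X P 1 (N + 1)) = X ^ (a + 1) * (X ^ ((N + 1) * (a + 2)) * c +
          X ^ ((N + 1) * (a + 3)) * u + X ^ ((N + 1) * (a + 4)) * e) := by
      rw [h.squareSum_one_succ, show u = (1 - X ^ (N + 1)) * e - c by rw [hrel]; ring, hc, he]
      ring
    rw [h1, h2, coeff_X_pow_mul', coeff_X_pow_mul']
    by_cases han : a + 1 ≤ n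
    -- The range `n + 2` is larger than the sum requires, so that gaps `2` and `3` can be peeled off
    -- and `range n` remains.
    · rw [if_pos han, if_pos han, sum_rrLists_succ _ _ _ _ han, sum_rrLists_succ _ _ _ _ han,
        sum_range_succ', sum_range_succ', sum_range_succ', sum_range_succ']
      have hcons : ∀ d, ∀ l ∈ rrLists N (a + 1 + 2 + d) (n - (a + 1)),
          ∃ l', l = (a + 3 + d) :: l' := by
        intro d l hl
        rw [mem_rrLists] at hl
        rcases l with _ | ⟨b, l⟩
        · simp at hl
        · refine ⟨l, ?_⟩
          have := hl.2.1
          simp only [List.head?_cons, Option.some.injEq] at this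
          rw [this]
      have w0 : ∀ l ∈ rrLists N (a + 1 + 2 + 0) (n - (a + 1)),
          runWeights ((a + 1) :: l) = runWeights l := by
        intro l hl
        obtain ⟨l', rfl⟩ := hcons 0 l hl
        rw [runWeights, if_pos (by omega)]
      have w1 : ∀ l ∈ rrLists N (a + 1 + 2 + (0 + 1)) (n - (a + 1)),
          runWeights ((a + 1) :: l) = ((runWeights l).1 + (runWeights l).2, (runWeights l).1) := by
        intro l hl
        obtain ⟨l', rfl⟩ := hcons (0 + 1) l hl
        rw [runWeights, if_neg (by omega), if_pos (by omega)]
      have w2 : ∀ d, ∀ l ∈ rrLists N (a + 1 + 2 + (d + 1 + 1)) (n - (a + 1)),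
          runWeights ((a + 1) :: l) = ((runWeights l).1 + (runWeights l).2,
            (runWeights l).1 + (runWeights l).2) := by
        intro d l hl
        obtain ⟨l', rfl⟩ := hcons (d + 1 + 1) l hl
        rw [runWeights, if_neg (by omega), if_neg (by omega)]
      have s0 : ∀ f : ℕ × ℕ → ℤ, ∑ l ∈ rrLists N (a + 1 + 2 + 0) (n - (a + 1)),
          f (runWeights ((a + 1) :: l)) = ∑ l ∈ rrLists N (a + 2 + 1) (n - (a + 1)),
            f (runWeights l) := fun f => by
        rw [sum_congr rfl fun l hl => by rw [w0 l hl]]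
      have s1 : ∀ f : ℕ × ℕ → ℤ, ∑ l ∈ rrLists N (a + 1 + 2 + (0 + 1)) (n - (a + 1)),
          f (runWeights ((a + 1) :: l)) = ∑ l ∈ rrLists N (a + 3 + 1) (n - (a + 1)),
            f ((runWeights l).1 + (runWeights l).2, (runWeights l).1) := fun f => by
        rw [sum_congr rfl fun l hl => by rw [w1 l hl]]
      have s2 : ∀ f : ℕ × ℕ → ℤ, ∑ d ∈ range n,
          ∑ l ∈ rrLists N (a + 1 + 2 + (d + 1 + 1)) (n - (a + 1)),
          f (runWeights ((a + 1) :: l)) = ∑ d ∈ range n,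
          ∑ l ∈ rrLists N (a + 4 + d + 1) (n - (a + 1)),
            f ((runWeights l).1 + (runWeights l).2, (runWeights l).1 + (runWeights l).2) :=
        fun f => sum_congr rfl fun d _ => by
          rw [sum_congr rfl fun l hl => by rw [w2 d l hl],
            show a + 1 + 2 + (d + 1 + 1) = a + 4 + d + 1 by ring]
      have tail : ∑ d ∈ range n, ∑ l ∈ rrLists N (a + 4 + d + 1) (n - (a + 1)),
          (((runWeights l).1 + (runWeights l).2 : ℕ) : ℤ) =
          coeff (n - (a + 1)) (X ^ ((N + 1) * (a + 4)) * e) := by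
        rw [← coeff_sum_pow_mul (n := n) hrel (by omega), map_sum]
        refine sum_congr rfl fun d _ => ?_
        simp only [Nat.cast_add, sum_add_distrib]
        rw [(ih _ _).1, (ih _ _).2, mul_add _ u c, map_add]
      constructor
      · rw [s0 fun p => (p.1 : ℤ), s1 fun p => (p.1 : ℤ), s2 fun p => (p.1 : ℤ), tail]
        simp only [Nat.cast_add, sum_add_distrib]
        rw [(ih _ _).1, (ih _ _).1, (ih _ _).2, mul_add _ u c]
        simp only [map_add]
        ring
      · rw [s0 fun p => (p.2 : ℤ), s1 fun p => (p.2 : ℤ), s2 fun p => (p.2 : ℤ), tail]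
        rw [(ih _ _).1, (ih _ _).2]
        simp only [map_add]
        ring
    · rw [if_neg han, if_neg han, rrLists, if_neg han]
      simp

/-- The generating function of weighted Rogers–Ramanujan lists of given length without `1`. -/
theorem sum_listWeight (h : IsQFactorialInv X P) (N n : ℕ) :
    ∑ d ∈ range (n + 2), ∑ l ∈ rrLists N (2 + d) n, (listWeight l : ℤ) =
      coeff n (X ^ ((N + 1) ^ 2 + (N + 1)) * squareSum X P 1 (N + 1)) := by
  set u := (X : ℤ⟦X⟧) ^ ((N + 1) ^ 2) * squareSum X P 0 N with hu
  set c := (X : ℤ⟦X⟧) ^ ((N + 1) ^ 2) * squareSum X P 1 N with hc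
  set e := (X : ℤ⟦X⟧) ^ ((N + 1) ^ 2) * squareSumNeg X P (N + 1) with he
  have hrel : (1 - X ^ (N + 1)) * e = u + c := by
    rw [hu, hc, he]
    linear_combination (X ^ ((N + 1) ^ 2)) * h.one_sub_mul_squareSumNeg N
  -- Smallest part `≥ 4`, `3` and `2`, in this order: the recurrence for the second component, with
  -- the new part equal to `0`.
  have h1 : (X : ℤ⟦X⟧) ^ ((N + 1) ^ 2 + (N + 1)) * squareSum X P 1 (N + 1) =
      X ^ ((N + 1) * 3) * e + X ^ ((N + 1) * 2) * u + X ^ ((N + 1) * 1) * c := by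
    rw [h.squareSum_one_succ, show u = (1 - X ^ (N + 1)) * e - c by rw [hrel]; ring, hc, he]
    ring
  have hcons : ∀ a, ∀ l ∈ rrLists N a n, ∃ l', l = a :: l' ∧
      (a :: l').IsChain fun a b => a + 2 ≤ b := by
    intro a l hl
    rw [mem_rrLists] at hl
    rcases l with _ | ⟨b, l⟩
    · simp at hl
    · have := hl.2.1
      simp only [List.head?_cons, Option.some.injEq] at this
      subst this
      exact ⟨l, rfl, hl.2.2.1⟩
  have s0 : ∑ l ∈ rrLists N (2 + 0) n, (listWeight l : ℤ) =
      ∑ l ∈ rrLists N (1 + 1) n, ((runWeights l).2 : ℤ) :=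
    sum_congr rfl fun l hl => by
      obtain ⟨l', rfl, hl'⟩ := hcons _ l hl
      rw [listWeight_two_cons hl']
  have s1 : ∑ l ∈ rrLists N (2 + (0 + 1)) n, (listWeight l : ℤ) =
      ∑ l ∈ rrLists N (2 + 1) n, ((runWeights l).1 : ℤ) :=
    sum_congr rfl fun l hl => by
      obtain ⟨l', rfl, hl'⟩ := hcons _ l hl
      rw [listWeight_three_cons hl']
  have s2 : ∀ d, ∑ l ∈ rrLists N (2 + (d + 1 + 1)) n, (listWeight l : ℤ) =
      ∑ l ∈ rrLists N (3 + d + 1) n, (((runWeights l).1 : ℤ) + (runWeights l).2) := by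
    intro d
    rw [show 2 + (d + 1 + 1) = 3 + d + 1 by ring]
    refine sum_congr rfl fun l hl => ?_
    obtain ⟨l', rfl, hl'⟩ := hcons _ l hl
    rw [listWeight_cons_of_four_le (by omega) hl', Nat.cast_add]
  rw [sum_range_succ', sum_range_succ', s0, s1, (sum_runWeights h _ _ _).1,
    (sum_runWeights h _ _ _).2, h1, map_add, map_add,
    ← coeff_sum_pow_mul (n := n) hrel (by omega), map_sum]
  congr 2
  refine sum_congr rfl fun d _ => ?_
  rw [s2, sum_add_distrib, (sum_runWeights h _ _ _).1, (sum_runWeights h _ _ _).2,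
    mul_add _ u c, map_add]

end

/-! ### From lists to partitions -/

theorem isChain_le_of_isChain_add_two_le {l : List ℕ} (h : l.IsChain fun a b => a + 2 ≤ b) :
    l.Pairwise (· ≤ ·) :=
  List.isChain_iff_pairwise.1 (h.imp fun _ _ hab => by omega)

/-- The lists of parts of the Rogers–Ramanujan partitions of `n` without `1` and with at most `K`
parts. -/
def rrListsWithoutOne (K n : ℕ) : Finset (List ℕ) :=
  (if n = 0 then {[]} else ∅) ∪
    (range K).biUnion fun N => (range (n + 2)).biUnion fun d => rrLists N (2 + d) n

theorem mem_rrListsWithoutOne {K n : ℕ} (hK : n ≤ K) {l : List ℕ} :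
    l ∈ rrListsWithoutOne K n ↔
      l.IsChain (fun a b => a + 2 ≤ b) ∧ l.sum = n ∧ ∀ p ∈ l, 2 ≤ p := by
  rw [rrListsWithoutOne, mem_union]
  simp only [mem_biUnion, mem_range, mem_rrLists]
  rcases l with _ | ⟨a, l⟩
  · split_ifs with h
    · simp [h]
    · simpa using fun h' => h h'.symm
  · have h0 : a :: l ∉ (if n = 0 then ({[]} : Finset (List ℕ)) else ∅) := by
      split_ifs <;> simp
    simp only [h0, false_or]
    constructor
    · rintro ⟨N, -, d, -, -, h2, h3, h4⟩
      refine ⟨h3, h4, ?_⟩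
      simp only [List.head?_cons, Option.some.injEq] at h2
      intro p hp
      rcases List.mem_cons.1 hp with rfl | hp
      · omega
      · have := (List.pairwise_cons.1 (isChain_le_of_isChain_add_two_le h3)).1 p hp
        omega
    · rintro ⟨h3, h4, h5⟩
      have ha := h5 a (by simp)
      have hlen : (a :: l).length ≤ (a :: l).sum :=
        List.length_le_sum_of_one_le _ fun p hp => by have := h5 p hp; omega
      rw [List.length_cons, h4] at hlen
      rw [List.sum_cons] at h4
      refine ⟨l.length, by omega, a - 2, by omega, rfl, ?_, h3, by simpa using h4⟩
      rw [List.head?_cons, Nat.add_sub_cancel' ha]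

theorem sum_rrListsWithoutOne {M : Type*} [AddCommMonoid M] (f : List ℕ → M) (K n : ℕ) :
    ∑ l ∈ rrListsWithoutOne K n, f l = (if n = 0 then f [] else 0) +
      ∑ N ∈ range K, ∑ d ∈ range (n + 2), ∑ l ∈ rrLists N (2 + d) n, f l := by
  rw [rrListsWithoutOne, sum_union, sum_biUnion]
  · congr 1
    · split_ifs <;> simp
    · refine sum_congr rfl fun N _ => sum_biUnion fun d _ e _ hde => ?_
      exact pairwiseDisjoint_rrLists N n Set.univ (Set.mem_univ _) (Set.mem_univ _) (by omega)
  · intro N _ N' _ hN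
    rw [Function.onFun, disjoint_left]
    intro l h1 h2
    simp only [mem_biUnion, mem_rrLists] at h1 h2
    obtain ⟨_, _, h1, _⟩ := h1
    obtain ⟨_, _, h2, _⟩ := h2
    omega
  · rw [disjoint_left]
    intro l h1 h2
    simp only [mem_biUnion, mem_rrLists] at h2
    obtain ⟨_, _, _, _, h2, _⟩ := h2
    split_ifs at h1
    · simp_all
    · simp at h1

theorem sum_partitionWeight {K n : ℕ} (hK : n ≤ K) :
    ∑ π ∈ rogersRamanujanWithoutOne n, partitionWeight π =
      ∑ l ∈ rrListsWithoutOne K n, listWeight l := by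
  refine sum_nbij sortedParts ?_ ?_ ?_ fun π _ => rfl
  · intro π hπ
    rw [rogersRamanujanWithoutOne, mem_filter] at hπ
    rw [mem_rrListsWithoutOne hK]
    refine ⟨hπ.2.1, ?_, ?_⟩
    · rw [← Multiset.sum_coe, sortedParts, Multiset.sort_eq, π.parts_sum]
    · intro p hp
      rw [sortedParts, Multiset.mem_sort] at hp
      have h0 := π.parts_pos hp
      have h1 : p ≠ 1 := fun h => hπ.2.2 (h ▸ hp)
      omega
  · intro π _ π' _ h
    have h' := congrArg (fun l : List ℕ => (l : Multiset ℕ)) h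
    simp only [sortedParts, Multiset.sort_eq] at h'
    exact Nat.Partition.ext h'
  · intro l hl
    rw [mem_coe, mem_rrListsWithoutOne hK] at hl
    obtain ⟨h1, h2, h3⟩ := hl
    let π : n.Partition := ⟨l, fun {p} hp => by have := h3 p hp; omega, by simpa using h2⟩
    have hπ : sortedParts π = l := by
      have hs : (sortedParts π).Pairwise (· ≤ ·) := Multiset.pairwise_sort _ _
      refine List.Perm.eq_of_pairwise' hs (isChain_le_of_isChain_add_two_le h1) ?_
      rw [← Multiset.coe_eq_coe, sortedParts, Multiset.sort_eq]
    refine ⟨π, ?_, hπ⟩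
    rw [mem_coe, rogersRamanujanWithoutOne, mem_filter]
    refine ⟨mem_univ _, ?_, fun h => ?_⟩
    · rw [IsRogersRamanujan, hπ]
      exact h1
    · have := h3 1 h
      omega

theorem theorem7 (n : ℕ) :
    numPartitionsModSeven n = ∑ π ∈ rogersRamanujanWithoutOne n, partitionWeight π := by
  obtain ⟨K, hK, hn⟩ :=
    ((numPartitionsModSeven_eq_coeff n).and (Filter.eventually_ge_atTop n)).exists
  have h := isQFactorialInv_qFactorialInv (q := X) (by simp)
  zify
  -- The summation index is the number of parts; the term of index `0` is the empty partition.
  rw [hK, ← Nat.cast_sum, sum_partitionWeight hn, Nat.cast_sum, sum_rrListsWithoutOne,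
    sum_range_succ', map_add, map_sum, add_comm]
  congr 1
  · simp [squareSum, h.zero, coeff_one, listWeight]
  · exact sum_congr rfl fun N _ => (sum_listWeight h N n).symm
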